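/- Let $1\le m\le n$ be integers and let $\mathrm{Gr}(m,m+n)$ be the Grassmannian of $m$-dimensional subspaces of $\mathbb{R}^{m+n}$. A representative of $V\in\mathrm{Gr}(m,m+n)$ is a real $(m+n)\times m$ matrix $A$ whose column space is $V$; for an $m$-element subset $I\subset[m+n]:=\{1,\dots,m+n\}$ its Plücker coordinate $\Delta_I(A)$ is the determinant of the submatrix of $A$ formed by the rows in $I$ (taken in increasing order) and all $m$ columns. Let $\mathrm{Gr}^{\ge 0}(m,m+n)$ be the set of those $V$ that have a representative all of whose Plücker coordinates are nonnegative. For $V\in \mathrm{Gr}^{\ge 0}(m,m+n)$ put $$\mathcal{M}_V:=\{I\subset[m+n] : |I|=m,\ \Delta_I(V)\neq 0\}$$ (the condition $\Delta_I(V)\ne 0$ does not depend on the representative of $V$) and $$\Pi_{\mathcal{M}_V,>0}:=\{W\in \mathrm{Gr}^{\ge 0}(m,m+n): \mathcal{M}_W=\mathcal{M}_V\}.$$ For $I=\{i_1<\dots<i_m\}$ and $J=\{j_1<\dots<j_m\}$ let $\max(I,J):=\{\max(i_k,j_k):k\in[m]\}$ and $\min(I,J):=\{\min(i_k,j_k):k\in[m]\}$.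 A function $g$ from a distributive lattice $(\mathcal{L},\vee,\wedge)$ to $\mathbb{R}_{>0}$ is log-supermodular if $\log g(x\vee y)+\log g(x\wedge y)\ge \log g(x)+\log g(y)$ for all $x,y\in\mathcal{L}$. Let $V\in\mathrm{Gr}^{\ge 0}(m,m+n)$ and $W\in\Pi_{\mathcal{M}_V,>0}$, and let $A$ be any representative of $W$ with $\Delta_I(A)\ge 0$ for all $m$-element $I\subset[m+n]$. Then $\mathcal{M}_V$ is a distributive lattice with join $\max$ and meet $\min$, the values $\Delta_I(A)$, $I\in\mathcal{M}_V$, are positive, and the map $I\mapsto\Delta_I(A)$ is log-supermodular on this lattice. -/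

import Mathlib

namespace TNNGrass

/-- The `m`-element subsets of an index set with `m + n` elements (`Fin (m + n)` in place of
`{1, …, m + n}`). -/
abbrev IndexSet (m n : ℕ) : Type := {I : Finset (Fin (m + n)) // I.card = m}

/-- The increasing enumeration `i_1 < ⋯ < i_m` of an `m`-element subset. -/
def IndexSet.enum {m n : ℕ} (I : IndexSet m n) : Fin m ↪o Fin (m + n) :=
  I.1.orderEmbOfFin I.2

theorem IndexSet.strictMono_max {m n : ℕ} (I J : IndexSet m n) :
    StrictMono fun k => max (I.enum k) (J.enum k) := fun _ _ h =>
  max_lt_max (I.enum.strictMono h) (J.enum.strictMono h)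

theorem IndexSet.strictMono_min {m n : ℕ} (I J : IndexSet m n) :
    StrictMono fun k => min (I.enum k) (J.enum k) := fun _ _ h =>
  min_lt_min (I.enum.strictMono h) (J.enum.strictMono h)

/-- `max(I, J) = {max(i_k, j_k) : k}`. -/
def IndexSet.maxSet {m n : ℕ} (I J : IndexSet m n) : IndexSet m n :=
  ⟨Finset.univ.image fun k => max (I.enum k) (J.enum k), by
    rw [Finset.card_image_of_injective _ (I.strictMono_max J).injective, Finset.card_fin]⟩

/-- `min(I, J) = {min(i_k, j_k) : k}`. -/
def IndexSet.minSet {m n : ℕ} (I J : IndexSet m n) : IndexSet m n :=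
  ⟨Finset.univ.image fun k => min (I.enum k) (J.enum k), by
    rw [Finset.card_image_of_injective _ (I.strictMono_min J).injective, Finset.card_fin]⟩

/-- `Δ_I(A)`: the maximal minor of the `(m + n) × m` matrix `A` with row set `I`. -/
def plucker {m n : ℕ} (A : Matrix (Fin (m + n)) (Fin m) ℝ) (I : IndexSet m n) : ℝ :=
  (A.submatrix I.enum id).det

/-- The Grassmannian `Gr(m, m + n)` of `m`-dimensional vector subspaces of `ℝ^(m + n)`. -/
def Gr (m n : ℕ) : Type :=
  {V : Submodule ℝ (Fin (m + n) → ℝ) // Module.finrank ℝ V = m}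

/-- `A` is a matrix representative of `V`: its column space is `V` (it then has full rank, because
`V` has dimension `m`). -/
def Represents {m n : ℕ} (A : Matrix (Fin (m + n)) (Fin m) ℝ) (V : Gr m n) : Prop :=
  Submodule.span ℝ (Set.range A.col) = V.1

/-- The totally nonnegative Grassmannian `Gr^{≥0}(m, m + n)`: the subspaces all of whose Plücker
coordinates are nonnegative for some matrix representative. -/
def GrNonneg (m n : ℕ) : Set (Gr m n) :=
  {V | ∃ A : Matrix (Fin (m + n)) (Fin m) ℝ, Represents A V ∧ ∀ I, 0 ≤ plucker A I}

/-- `𝓜_V`: the index sets `I` with `Δ_I(V) ≠ 0`. This does not depend on the representative of `V`,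
see `mem_positroid_iff`. -/
def positroid {m n : ℕ} (V : Gr m n) : Set (IndexSet m n) :=
  {I | ∃ A : Matrix (Fin (m + n)) (Fin m) ℝ, Represents A V ∧ plucker A I ≠ 0}

theorem mem_positroid_iff {m n : ℕ} {V : Gr m n} {A : Matrix (Fin (m + n)) (Fin m) ℝ}
    (hA : Represents A V) (I : IndexSet m n) : I ∈ positroid V ↔ plucker A I ≠ 0 := by
  refine ⟨?_, fun h => ⟨A, hA, h⟩⟩
  rintro ⟨B, hB, h⟩ h0
  have hmem : ∀ j, ∃ c : Fin m → ℝ, ∑ k, c k • A.col k = B.col j := fun j => by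
    rw [← Submodule.mem_span_range_iff_exists_fun, show _ = _ from hA, ← show _ = _ from hB]
    exact Submodule.subset_span ⟨j, rfl⟩
  choose c hc using hmem
  have hBA : B = A * Matrix.of fun k j => c j k := by
    ext i j
    have := congrFun (hc j) i
    simp only [Finset.sum_apply, Pi.smul_apply, smul_eq_mul, Matrix.col_apply] at this
    simp [Matrix.mul_apply, ← this, mul_comm]
  apply h
  have hmul : B.submatrix I.enum id =
      A.submatrix I.enum id * Matrix.of fun k j => c j k := by
    rw [hBA]
    rfl
  have h0' : (A.submatrix I.enum id).det = 0 := h0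
  rw [plucker, hmul, Matrix.det_mul, h0', zero_mul]

/-- The positroid cell `Π_{𝓜_V,>0} = {W ∈ Gr^{≥0}(m, m + n) : 𝓜_W = 𝓜_V}`. -/
def positroidCell {m n : ℕ} (V : Gr m n) : Set (Gr m n) :=
  {W | W ∈ GrNonneg m n ∧ positroid W = positroid V}

/-- Supermodular real functions on a distributive lattice. -/
def Supermodular {L : Type*} [DistribLattice L] (f : L → ℝ) : Prop :=
  ∀ x y : L, f x + f y ≤ f (x ⊔ y) + f (x ⊓ y)

/-- A function is log-supermodular if its values are positive and its logarithm is
supermodular. -/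
def LogSupermodular {L : Type*} [DistribLattice L] (g : L → ℝ) : Prop :=
  (∀ x : L, 0 < g x) ∧ Supermodular fun x => Real.log (g x)

end TNNGrass

open Matrix Function

namespace TNNGrass

/-! It all reduces to Δ_I Δ_J ≤ Δ_{min(I,J)} Δ_{max(I,J)} for a matrix with nonnegative maximal
minors (`rowMinor_mul_le_inf_mul_sup`): if the left side is positive, both factors on the right are
too, so the positroid is closed under max and min, and taking logarithms finishes.

When I and J each raise one entry of a common set by 1, the inequality is a three-term Plücker
relation whose remaining product has a favourable sign (`rowMinor_mul_le_of_covers`). If all minors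
are positive, such local inequalities multiply up along chains to arbitrary pairs
(`mul_le_mul_of_local`).

Vanishing minors are removed by perturbation: adding t > 0 times an adjacent row to a row lowers no
minor and, for a suitable choice, makes some zero minor positive (`exists_adjacent_of_zero_of_pos`).
Induction on the number of zero minors and t → 0 give the general case. -/

/-! ### Three-term Plücker relation. -/

theorem det_mul_det_updateRow_updateRow {ι R : Type*} [Fintype ι] [DecidableEq ι] [CommRing R]
    (M : Matrix ι ι R) {p q : ι} (hpq : p ≠ q) (u v : ι → R) :
    M.det * ((M.updateRow p u).updateRow q v).det =
      (M.updateRow p u).det * (M.updateRow q v).det -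
        (M.updateRow q u).det * (M.updateRow p v).det := by
  -- Cramer's rule expands `v` in the rows of `M`; once this is put in row `q`, only the terms `k =
  -- p` and `k = q` avoid a repeated row.
  have hv : M.det • v = ∑ k, (M.updateRow k v).det • M k := by
    have h := mulVec_cramer Mᵀ v
    rw [det_transpose] at h
    rw [← h, mulVec_transpose, vecMul_eq_sum]
    simp only [cramer_transpose_apply]
  have hzero : ∀ k, k ≠ p → k ≠ q → ((M.updateRow p u).updateRow q (M k)).det = 0 := by
    intro k hkp hkq
    refine det_zero_of_row_eq hkq ?_
    simp [updateRow_ne hkq, updateRow_ne hkp]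
  have hq : ((M.updateRow p u).updateRow q (M q)).det = (M.updateRow p u).det := by
    congr 1
    conv_rhs => rw [← updateRow_eq_self (M.updateRow p u) q, updateRow_ne hpq.symm]
  have hp : ((M.updateRow p u).updateRow q (M p)).det = -(M.updateRow q u).det := by
    have h := det_permute (Equiv.swap p q) (M.updateRow q u)
    rw [Equiv.Perm.sign_swap hpq] at h
    have e : (M.updateRow p u).updateRow q (M p) =
        (M.updateRow q u).submatrix (Equiv.swap p q) id := by
      ext i j
      by_cases hi : i = q
      · subst hi; simp [updateRow_ne hpq]
      · by_cases hi' : i = p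
        · subst hi'; simp [updateRow_ne hpq]
        · simp [updateRow_ne hi, updateRow_ne hi', Equiv.swap_apply_of_ne_of_ne hi' hi]
    rw [e, h]
    simp
  rw [← det_updateRow_smul, hv]
  have hsum : ∀ s : Finset ι,
      ((M.updateRow p u).updateRow q (∑ k ∈ s, (M.updateRow k v).det • M k)).det =
        ∑ k ∈ s, (M.updateRow k v).det * ((M.updateRow p u).updateRow q (M k)).det := by
    intro s
    induction s using Finset.induction_on with
    | empty => simpa using det_eq_zero_of_row_eq_zero q (by simp)
    | insert a s ha ih =>
      rw [Finset.sum_insert ha, Finset.sum_insert ha, det_updateRow_add, det_updateRow_smul, ih]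
  rw [hsum, Fintype.sum_eq_add q p hpq.symm (fun k hk => by rw [hzero k hk.2 hk.1, mul_zero]),
    hq, hp]
  ring

/-! ### Minors along integer sequences, and the local inequality. -/

/-- The minor of the array `r` on the rows `g 0, g 1, …`, in this order. -/
def rowMinor {m : ℕ} (r : ℕ → Fin m → ℝ) (g : Fin m → ℕ) : ℝ :=
  (Matrix.of fun k => r (g k)).det

/-- Strictly increasing sequences with values below `N`. -/
def IsIndex {m : ℕ} (N : ℕ) (g : Fin m → ℕ) : Prop :=
  StrictMono g ∧ ∀ k, g k < N

theorem of_comp_update {m : ℕ} (r : ℕ → Fin m → ℝ) (g : Fin m → ℕ) (p : Fin m) (a : ℕ) :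
    (Matrix.of fun k => r (update g p a k)) = (Matrix.of fun k => r (g k)).updateRow p (r a) := by
  ext i j
  by_cases h : i = p
  · subst h; simp
  · simp [h]

theorem rowMinor_update {m : ℕ} (r : ℕ → Fin m → ℝ) (g : Fin m → ℕ) (p : Fin m) (a : ℕ) :
    rowMinor r (update g p a) = ((Matrix.of fun k => r (g k)).updateRow p (r a)).det := by
  rw [rowMinor, of_comp_update]

theorem rowMinor_plucker_relation {m : ℕ} (r : ℕ → Fin m → ℝ) (g : Fin m → ℕ) {p q : Fin m}
    (hpq : p ≠ q) (a b : ℕ) :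
    rowMinor r g * rowMinor r (update (update g p a) q b) =
      rowMinor r (update g p a) * rowMinor r (update g q b) -
        rowMinor r (update g q a) * rowMinor r (update g p b) := by
  simp only [rowMinor_update, of_comp_update]
  exact det_mul_det_updateRow_updateRow _ hpq _ _

theorem rowMinor_eq_zero {m : ℕ} (r : ℕ → Fin m → ℝ) {g : Fin m → ℕ} {i j : Fin m} (hij : i ≠ j)
    (h : g i = g j) : rowMinor r g = 0 :=
  det_zero_of_row_eq hij (congrArg r h)

theorem rowMinor_comp_perm {m : ℕ} (r : ℕ → Fin m → ℝ) (g : Fin m → ℕ)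
    (σ : Equiv.Perm (Fin m)) :
    rowMinor r (g ∘ σ) = Equiv.Perm.sign σ * rowMinor r g :=
  det_permute σ (Matrix.of fun k => r (g k))

theorem val_cycleIcc {m : ℕ} {i j : Fin m} (hij : i ≤ j) (k : Fin m) :
    (Fin.cycleIcc i j k : ℕ) =
      if k < i then (k : ℕ) else if k < j then k + 1 else if k = j then (i : ℕ) else k := by
  have : NeZero m := ⟨by have := i.2; omega⟩
  split_ifs with h1 h2 h3
  · rw [Fin.cycleIcc_of_lt h1]
  · rw [Fin.cycleIcc_of_ge_of_lt (not_lt.1 h1) h2, Fin.val_add_one_of_lt' (by have := j.2; omega)]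
  · rw [h3, Fin.cycleIcc_of_last hij]
  · rw [Fin.cycleIcc_of_gt (lt_of_le_of_ne (not_lt.1 h2) (Ne.symm h3))]

/-- `σ k` is the rank of `h k` among the entries, so `h ∘ σ.symm` is increasing and its minor serves
as `c`. -/
theorem exists_rowMinor_eq_sign_mul {m N : ℕ} {r : ℕ → Fin m → ℝ}
    (hr : ∀ g, IsIndex N g → 0 ≤ rowMinor r g) {h : Fin m → ℕ} (hN : ∀ k, h k < N)
    (σ : Equiv.Perm (Fin m)) (hσ : ∀ i j, σ i < σ j → h i < h j) :
    ∃ c : ℝ, 0 ≤ c ∧ rowMinor r h = Equiv.Perm.sign σ * c := by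
  refine ⟨rowMinor r (h ∘ σ.symm), hr _ ⟨fun i j hij => hσ _ _ (by simpa using hij),
    fun k => hN _⟩, ?_⟩
  rw [← rowMinor_comp_perm, comp_assoc]
  simp

/-- The second product of the three-term relation has the sign which gives the inequality. -/
theorem rowMinor_cross_nonpos {m N : ℕ} {r : ℕ → Fin m → ℝ}
    (hr : ∀ g, IsIndex N g → 0 ≤ rowMinor r g) {g : Fin m → ℕ} (hg : IsIndex N g) {p q : Fin m}
    (hpq : p < q) (hp : IsIndex N (update g p (g p + 1))) (hq : IsIndex N (update g q (g q + 1))) :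
    rowMinor r (update g q (g p + 1)) * rowMinor r (update g p (g q + 1)) ≤ 0 := by
  have hgp : ∀ k, p < k → g p + 1 < g k := fun k hk => by
    simpa [hk.ne'] using hp.1 hk
  have hgq : ∀ k, q < k → g q + 1 < g k := fun k hk => by
    simpa [hk.ne'] using hq.1 hk
  have hN : ∀ k, g k < N := hg.2
  have hpN : g q + 1 < N := by simpa using hq.2 q
  have hmono : ∀ i j, i < j → g i < g j := fun i j h => hg.1 h
  obtain ⟨p', hp'⟩ : ∃ p' : Fin m, (p' : ℕ) = p + 1 := ⟨⟨p + 1, by omega⟩, rfl⟩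
  -- The entry `g p + 1` at place `q` has rank `p + 1`: sorting costs the sign (-1)^(q-p-1).
  obtain ⟨c, hc, e⟩ := exists_rowMinor_eq_sign_mul hr (h := update g q (g p + 1))
    (fun k => by by_cases h : k = q <;> grind) (Fin.cycleIcc p' q) (by
      intro i j hij
      rw [Fin.lt_def, val_cycleIcc (by omega), val_cycleIcc (by omega)] at hij
      have := hmono i j
      have := hmono i p
      have := hgp j
      simp only [update_apply]
      clear hr hg hp hq hmono hN
      grind)
  -- The entry `g q + 1` at place `p` has rank `q`: the sign is (-1)^(q-p), opposite to the previous
  -- one.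
  obtain ⟨d, hd, f⟩ := exists_rowMinor_eq_sign_mul hr (h := update g p (g q + 1))
    (fun k => by by_cases h : k = p <;> grind) (Fin.cycleIcc p q).symm (by
      intro i j hij
      obtain ⟨i, rfl⟩ := (Fin.cycleIcc p q).surjective i
      obtain ⟨j, rfl⟩ := (Fin.cycleIcc p q).surjective j
      rw [Equiv.symm_apply_apply, Equiv.symm_apply_apply] at hij
      have hi := val_cycleIcc hpq.le i
      have hj := val_cycleIcc hpq.le j
      generalize Fin.cycleIcc p q i = x at hi ⊢
      generalize Fin.cycleIcc p q j = y at hj ⊢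
      have := hmono x y
      have := hmono x q
      have := hgq y
      simp only [update_apply]
      clear hr hg hp hq hmono hN e
      grind)
  rw [e, f, Equiv.Perm.sign_symm, Fin.sign_cycleIcc_of_le (by omega),
    Fin.sign_cycleIcc_of_le hpq.le, hp']
  obtain ⟨l, hl⟩ : ∃ l : ℕ, (q : ℕ) = p + 1 + l := ⟨q - p - 1, by omega⟩
  rw [hl, show (p + 1 + l - (p + 1) : ℕ) = l by omega, show (p + 1 + l - p : ℕ) = l + 1 by omega]
  have h1 : ((-1 : ℝ) ^ l) * (-1) ^ l = 1 := by rw [← mul_pow]; simp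
  have h2 := mul_nonneg hc hd
  push_cast
  rw [pow_succ]
  linear_combination h2 - c * d * h1

theorem rowMinor_mul_le_of_covers {m N : ℕ} {r : ℕ → Fin m → ℝ}
    (hr : ∀ g, IsIndex N g → 0 ≤ rowMinor r g) {g : Fin m → ℕ} (hg : IsIndex N g) {p q : Fin m}
    (hpq : p ≠ q) (hp : IsIndex N (update g p (g p + 1))) (hq : IsIndex N (update g q (g q + 1))) :
    rowMinor r (update g p (g p + 1)) * rowMinor r (update g q (g q + 1)) ≤
      rowMinor r g * rowMinor r (update (update g p (g p + 1)) q (g q + 1)) := by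
  wlog h : p < q generalizing p q
  · have := this hpq.symm hq hp (lt_of_le_of_ne (not_lt.1 h) hpq.symm)
    rwa [mul_comm, update_comm hpq]
  · rw [rowMinor_plucker_relation r g hpq]
    linarith [rowMinor_cross_nonpos hr hg h hp hq]

/-! ### From local to global inequalities along chains. -/

theorem IsIndex.sup {m N : ℕ} {g h : Fin m → ℕ} (hg : IsIndex N g) (hh : IsIndex N h) :
    IsIndex N (g ⊔ h) :=
  ⟨fun _ _ hij => max_lt_max (hg.1 hij) (hh.1 hij), fun k => max_lt (hg.2 k) (hh.2 k)⟩

theorem IsIndex.inf {m N : ℕ} {g h : Fin m → ℕ} (hg : IsIndex N g) (hh : IsIndex N h) :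
    IsIndex N (g ⊓ h) :=
  ⟨fun _ _ hij => min_lt_min (hg.1 hij) (hh.1 hij), fun k => min_lt_of_left_lt (hg.2 k)⟩

/-- `v` arises from `u` by increasing one entry by `1`. -/
def Step {m : ℕ} (N : ℕ) (u v : Fin m → ℕ) : Prop :=
  IsIndex N u ∧ IsIndex N v ∧ ∃ q, v = update u q (u q + 1)

theorem Step.le {m N : ℕ} {u v : Fin m → ℕ} (h : Step N u v) : u ≤ v := by
  obtain ⟨-, -, q, rfl⟩ := h
  exact le_update_iff.2 ⟨Nat.le_succ _, fun _ _ => le_rfl⟩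

theorem le_of_reflTransGen_step {m N : ℕ} {u v : Fin m → ℕ}
    (h : Relation.ReflTransGen (Step N) u v) : u ≤ v := by
  induction h with
  | refl => exact le_rfl
  | tail _ h ih => exact ih.trans h.le

theorem exists_step {m N : ℕ} {u v : Fin m → ℕ} (hu : IsIndex N u) (hv : IsIndex N v)
    (huv : u < v) : ∃ w, Step N u w ∧ w ≤ v := by
  obtain ⟨hle, i, hi⟩ := Pi.lt_def.1 huv
  -- Raising the last entry where `u` and `v` differ cannot collide with a later one, since there
  -- `u` already equals `v`.
  obtain ⟨q, hq, hmax⟩ := (Finset.univ.filter fun i => u i < v i).exists_max_image id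
    ⟨i, by simpa using hi⟩
  have hq' : u q < v q := by simpa using hq
  have hqk : ∀ k, q < k → u k = v k := fun k hk => by
    by_contra hne
    exact absurd (hmax k (by simpa using lt_of_le_of_ne (hle k) hne)) (not_le.2 hk)
  refine ⟨update u q (u q + 1), ⟨hu, ⟨fun i j hij => ?_, fun k => ?_⟩, q, rfl⟩,
    update_le_iff.2 ⟨hq', fun j _ => hle j⟩⟩
  · have h1 := hu.1 hij
    have h2 := hv.1 hij
    have h3 := hqk j
    simp only [update_apply]
    grind
  · have h1 := hu.2 k
    have h2 := hv.2 k
    simp only [update_apply]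
    grind

theorem reflTransGen_step {m N : ℕ} {u v : Fin m → ℕ} (hu : IsIndex N u) (hv : IsIndex N v)
    (huv : u ≤ v) : Relation.ReflTransGen (Step N) u v := by
  induction hd : ∑ k, (v k - u k) using Nat.strong_induction_on generalizing u with
  | _ d ih =>
    rcases huv.eq_or_lt with rfl | hlt
    · exact .refl
    · obtain ⟨w, hw, hwv⟩ := exists_step hu hv hlt
      refine .head hw (ih _ ?_ hw.2.1 hwv rfl)
      rw [← hd]
      have hle := hw.le
      obtain ⟨-, -, q, hq⟩ := hw
      refine Finset.sum_lt_sum (fun k _ => Nat.sub_le_sub_left (hle k) _) ⟨q, Finset.mem_univ _, ?_⟩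
      have hwq : w q = u q + 1 := by rw [hq, update_self]
      have : w q ≤ v q := hwv q
      change v q - w q < v q - u q
      omega

/-- Log-supermodularity of a positive function follows from the case of two elements that cover
their meet. -/
theorem mul_le_mul_of_local {m N : ℕ} {F : (Fin m → ℕ) → ℝ} (hF : ∀ g, IsIndex N g → 0 < F g)
    (hloc : ∀ g p q, p ≠ q → IsIndex N g → IsIndex N (update g p (g p + 1)) →
      IsIndex N (update g q (g q + 1)) →
      F (update g p (g p + 1)) * F (update g q (g q + 1)) ≤
        F g * F (update (update g p (g p + 1)) q (g q + 1)))
    {x y : Fin m → ℕ} (hx : IsIndex N x) (hy : IsIndex N y) :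
    F x * F y ≤ F (x ⊓ y) * F (x ⊔ y) := by
  -- The ratio gained by raising entry `p` grows along a chain that leaves `p` fixed: local
  -- inequalities telescope, and positivity allows cancellation.
  have hcover : ∀ u v : Fin m → ℕ, Relation.ReflTransGen (Step N) u v → ∀ p, u p = v p →
      IsIndex N v → IsIndex N (update u p (u p + 1)) → IsIndex N (update v p (v p + 1)) →
      F (update u p (u p + 1)) * F v ≤ F u * F (update v p (v p + 1)) := by
    intro u v h p
    induction h using Relation.ReflTransGen.head_induction_on with
    | refl => intros; exact (mul_comm _ _).le
    | @head u w huw hwv ih =>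
      intro huv hv hu' hv'
      have h1 := huw.le p
      have h2 := le_of_reflTransGen_step hwv
      obtain ⟨hu, hw, q, rfl⟩ := huw
      set w := update u q (u q + 1) with hwdef
      have hpq : p ≠ q := by
        rintro rfl
        have hwp : w p = u p + 1 := by rw [hwdef, update_self]
        have : w p ≤ v p := h2 p
        omega
      have hwp : w p = u p := by rw [hwdef, update_of_ne hpq]
      have hw' : IsIndex N (update w p (w p + 1)) := by
        refine ⟨fun i j hij => ?_, fun k => ?_⟩
        · have a1 := hw.1 hij
          have a2 := hv'.1 hij
          have a3 := hu'.1 hij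
          have a4 := h2 i
          have a5 : u j ≤ w j := by
            rw [hwdef, update_apply]; split_ifs with h <;> simp [h]
          simp only [update_apply] at a2 a3 ⊢
          clear_value w
          grind
        · have a1 := hw.2 k
          have a2 := hu'.2 k
          simp only [update_apply] at a2 ⊢
          clear_value w
          grind
      have key1 := hloc u p q hpq hu hu' hw
      have key2 := ih (hwp.trans huv) hv hw' hv'
      have e : update (update u p (u p + 1)) q (u q + 1) = update w p (w p + 1) := by
        rw [hwp, hwdef, update_comm hpq]
      rw [e] at key1
      have pw := hF _ hw
      have pw' := hF _ hw'
      have pu := hF _ hu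
      refine le_of_mul_le_mul_right ?_ (mul_pos pw pw')
      calc F (update u p (u p + 1)) * F v * (F w * F (update w p (w p + 1)))
          = (F (update u p (u p + 1)) * F w) * (F (update w p (w p + 1)) * F v) := by ring
        _ ≤ (F u * F (update w p (w p + 1))) * (F w * F (update v p (v p + 1))) :=
            mul_le_mul key1 key2 (mul_pos pw' (hF _ hv)).le (mul_pos pu pw').le
        _ = F u * F (update v p (v p + 1)) * (F w * F (update w p (w p + 1))) := by ring
  -- Climbing from `x ⊓ y` to `x`, each raised entry `q` has `y q ≤ u q`, so `u` and `u ⊔ y` agree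
  -- there and `hcover` applies.
  have hsquare : ∀ u : Fin m → ℕ, Relation.ReflTransGen (Step N) u x → x ⊓ y ≤ u → IsIndex N u →
      F x * F (u ⊔ y) ≤ F u * F (x ⊔ y) := by
    intro u h
    induction h using Relation.ReflTransGen.head_induction_on with
    | refl => intros; exact le_rfl
    | @head u w huw hwx ih =>
      intro hinf hu
      have hw := huw.2.1
      have key2 := ih (hinf.trans huw.le) hw
      have hle := le_of_reflTransGen_step hwx
      obtain ⟨-, -, q, hq⟩ := huw
      have hlt : u q < x q := by simpa [hq] using hle q
      have hyq : y q ≤ u q := by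
        have := hinf q
        simp only [Pi.inf_apply] at this
        omega
      have huq : u q = (u ⊔ y) q := by simp [hyq]
      have e : update (u ⊔ y) q ((u ⊔ y) q + 1) = w ⊔ y := by
        rw [← huq, hq]
        ext k
        by_cases hk : k = q
        · subst hk
          simp only [update_self, Pi.sup_apply]
          omega
        · simp [hk]
      have hu' := hu.sup hy
      have hw' := hw.sup hy
      have key1 := hcover u (u ⊔ y) (reflTransGen_step hu hu' le_sup_left) q huq hu' (hq ▸ hw)
        (e ▸ hw')
      rw [e, ← hq] at key1
      have pw := hF _ hw
      have pw' := hF _ hw'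
      refine le_of_mul_le_mul_right ?_ (mul_pos pw pw')
      calc F x * F (u ⊔ y) * (F w * F (w ⊔ y))
          = (F x * F (w ⊔ y)) * (F w * F (u ⊔ y)) := by ring
        _ ≤ (F w * F (x ⊔ y)) * (F u * F (w ⊔ y)) :=
            mul_le_mul key2 key1 (mul_pos pw (hF _ hu')).le (mul_pos pw (hF _ (hx.sup hy))).le
        _ = F u * F (x ⊔ y) * (F w * F (w ⊔ y)) := by ring
  have h := hsquare (x ⊓ y) (reflTransGen_step (hx.inf hy) hx inf_le_left) le_rfl (hx.inf hy)
  rwa [sup_eq_right.2 (inf_le_right : x ⊓ y ≤ y)] at h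

/-! ### Perturbation by adjacent rows. -/

theorem rowMinor_update_of_forall_ne {m : ℕ} (r : ℕ → Fin m → ℝ) {g : Fin m → ℕ} {i : ℕ}
    (h : ∀ k, g k ≠ i) (x : Fin m → ℝ) : rowMinor (update r i x) g = rowMinor r g := by
  unfold rowMinor
  congr 2
  ext k : 1
  rw [update_of_ne (h k)]

theorem rowMinor_update_add_smul {m : ℕ} (r : ℕ → Fin m → ℝ) {g : Fin m → ℕ} (hg : Injective g)
    (p : Fin m) (j : ℕ) (t : ℝ) :
    rowMinor (update r (g p) (r (g p) + t • r j)) g =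
      rowMinor r g + t * rowMinor r (update g p j) := by
  have e : (Matrix.of fun k => update r (g p) (r (g p) + t • r j) (g k)) =
      (Matrix.of fun k => r (g k)).updateRow p (r (g p) + t • r j) := by
    ext k l
    by_cases h : k = p
    · subst h; simp
    · simp [h, hg.ne h]
  rw [rowMinor_update, rowMinor, e, det_updateRow_add, det_updateRow_smul]
  congr 1
  exact congrArg det (updateRow_eq_self _ _)

/-- Adjacent natural numbers. -/
def Adjacent (i j : ℕ) : Prop := i = j + 1 ∨ j = i + 1

theorem isIndex_update_of_adjacent {m N : ℕ} {g : Fin m → ℕ} (hg : IsIndex N g) {p : Fin m} {j : ℕ}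
    (hj : Adjacent (g p) j) (hjN : j < N) (hne : ∀ k, g k ≠ j) : IsIndex N (update g p j) := by
  refine ⟨fun a b hab => ?_, fun k => ?_⟩
  · have h1 := hg.1 hab
    have h2 := hne a
    have h3 := hne b
    unfold Adjacent at hj
    simp only [update_apply]
    grind
  · have := hg.2 k
    simp only [update_apply]
    grind

/-- Moving an entry to a neighbouring value either preserves the increasing order, so no sign
appears, or repeats a row. -/
theorem rowMinor_update_nonneg_of_adjacent {m N : ℕ} {r : ℕ → Fin m → ℝ}
    (hr : ∀ g, IsIndex N g → 0 ≤ rowMinor r g) {g : Fin m → ℕ} (hg : IsIndex N g) {p : Fin m}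
    {j : ℕ} (hj : Adjacent (g p) j) (hjN : j < N) : 0 ≤ rowMinor r (update g p j) := by
  by_cases hne : ∀ k, g k ≠ j
  · exact hr _ (isIndex_update_of_adjacent hg hj hjN hne)
  · obtain ⟨k, hk⟩ := not_forall_not.1 hne
    have hkp : k ≠ p := by
      rintro rfl
      unfold Adjacent at hj
      omega
    exact (rowMinor_eq_zero r hkp (by simp [hkp, hk])).ge

theorem rowMinor_le_rowMinor_perturb {m N : ℕ} {r : ℕ → Fin m → ℝ}
    (hr : ∀ g, IsIndex N g → 0 ≤ rowMinor r g) {i j : ℕ} (hij : Adjacent i j) (hjN : j < N)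
    {t : ℝ} (ht : 0 ≤ t) {g : Fin m → ℕ} (hg : IsIndex N g) :
    rowMinor r g ≤ rowMinor (update r i (r i + t • r j)) g := by
  by_cases h : ∃ p, g p = i
  · obtain ⟨p, rfl⟩ := h
    rw [rowMinor_update_add_smul r hg.1.injective]
    have := mul_nonneg ht (rowMinor_update_nonneg_of_adjacent hr hg hij hjN)
    linarith
  · rw [rowMinor_update_of_forall_ne r (not_exists.1 h)]

theorem continuous_rowMinor_perturb {m : ℕ} (r : ℕ → Fin m → ℝ) (i j : ℕ) (g : Fin m → ℕ) :
    Continuous fun t : ℝ => rowMinor (update r i (r i + t • r j)) g := by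
  unfold rowMinor
  refine Continuous.matrix_det (continuous_pi fun k => ?_)
  change Continuous fun t : ℝ => update r i (r i + t • r j) (g k)
  by_cases h : g k = i
  · simp only [h, update_self]
    fun_prop
  · have e : ∀ t : ℝ, update r i (r i + t • r j) (g k) = r (g k) := fun t => update_of_ne h _ _
    exact continuous_const.congr fun t => (e t).symm

/-- If some but not all minors vanish, then some vanishing minor becomes a nonvanishing one when
one of its rows is replaced by an adjacent row. -/
theorem exists_adjacent_of_zero_of_pos {m N : ℕ} {r : ℕ → Fin m → ℝ}
    (hr : ∀ g, IsIndex N g → 0 ≤ rowMinor r g) {x y : Fin m → ℕ} (hx : IsIndex N x)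
    (hy : IsIndex N y) (hx0 : 0 < rowMinor r x) (hy0 : rowMinor r y = 0) :
    ∃ g p j, IsIndex N g ∧ Adjacent (g p) j ∧ j < N ∧ rowMinor r g = 0 ∧
      0 < rowMinor r (update g p j) := by
  by_contra! hcon
  -- Otherwise positivity would pass along every step, up or down, hence from `x` through `x ⊓ y` to
  -- `y`.
  have hclosed : ∀ g p j, IsIndex N g → Adjacent (g p) j → j < N →
      0 < rowMinor r (update g p j) → 0 < rowMinor r g := fun g p j hg hj hjN hpos =>
    (hr g hg).lt_of_ne fun h => absurd hpos (not_lt.2 (hcon g p j hg hj hjN h.symm))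
  have hdown : ∀ u v, Step N u v → 0 < rowMinor r v → 0 < rowMinor r u := by
    rintro u v ⟨hu, hv, q, rfl⟩ hpos
    exact hclosed u q _ hu (.inr rfl) (by simpa using hv.2 q) hpos
  have hup : ∀ u v, Step N u v → 0 < rowMinor r u → 0 < rowMinor r v := by
    rintro u v ⟨hu, hv, q, rfl⟩ hpos
    exact hclosed _ q (u q) hv (.inl (by simp)) (hu.2 q) (by simpa using hpos)
  have hm := hx.inf hy
  have hdown' : ∀ u v, Relation.ReflTransGen (Step N) u v → 0 < rowMinor r v → 0 < rowMinor r u :=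
    fun u v h hv => h.head_induction_on hv fun h _ ih => hdown _ _ h ih
  have hup' : ∀ u v, Relation.ReflTransGen (Step N) u v → 0 < rowMinor r u → 0 < rowMinor r v := by
    intro u v h hu
    induction h with
    | refl => exact hu
    | tail _ h ih => exact hup _ _ h ih
  have h2 := hup' _ _ (reflTransGen_step hm hy inf_le_right)
    (hdown' _ _ (reflTransGen_step hm hx inf_le_left) hx0)
  exact h2.ne' hy0

theorem finite_setOf_isIndex (m N : ℕ) : {g : Fin m → ℕ | IsIndex N g}.Finite :=
  (Set.Finite.pi' fun _ => Set.finite_lt_nat N).subset fun _ hg => hg.2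

/-- The maximal minors of a matrix, if all of them are nonnegative, satisfy the lattice
inequality. -/
theorem rowMinor_mul_le_inf_mul_sup {m N : ℕ} {r : ℕ → Fin m → ℝ}
    (hr : ∀ g, IsIndex N g → 0 ≤ rowMinor r g) {x y : Fin m → ℕ} (hx : IsIndex N x)
    (hy : IsIndex N y) :
    rowMinor r x * rowMinor r y ≤ rowMinor r (x ⊓ y) * rowMinor r (x ⊔ y) := by
  induction hd : {g : Fin m → ℕ | IsIndex N g ∧ rowMinor r g = 0}.ncard using
    Nat.strong_induction_on generalizing r with
  | _ d ih =>
    by_cases hall : ∀ g, IsIndex N g → 0 < rowMinor r g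
    · exact mul_le_mul_of_local hall (fun g p q hpq hg hp hq =>
        rowMinor_mul_le_of_covers hr hg hpq hp hq) hx hy
    push Not at hall
    obtain ⟨z, hz, hz0⟩ := hall
    replace hz0 := le_antisymm hz0 (hr z hz)
    -- If the minor of `x` vanishes the claim is trivial; otherwise it is the positive minor needed
    -- to find a perturbation.
    rcases (hr x hx).eq_or_lt with hx0 | hx0
    · rw [← hx0, zero_mul]
      exact mul_nonneg (hr _ (hx.inf hy)) (hr _ (hx.sup hy))
    obtain ⟨g, p, j, hg, hj, hjN, hg0, hpos⟩ := exists_adjacent_of_zero_of_pos hr hx hz hx0 hz0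
    have hpert : ∀ t : ℝ, 0 < t →
        rowMinor (update r (g p) (r (g p) + t • r j)) x *
            rowMinor (update r (g p) (r (g p) + t • r j)) y ≤
          rowMinor (update r (g p) (r (g p) + t • r j)) (x ⊓ y) *
            rowMinor (update r (g p) (r (g p) + t • r j)) (x ⊔ y) := by
      intro t ht
      have hle := fun h (hh : IsIndex N h) => rowMinor_le_rowMinor_perturb hr hj hjN ht.le hh
      refine ih _ ?_ (fun h hh => (hr h hh).trans (hle h hh)) rfl
      rw [← hd]
      -- No new zeros appear, and `g` is no longer one.
      refine Set.ncard_lt_ncard ?_ ((finite_setOf_isIndex m N).subset fun _ h => h.1)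
      refine ⟨fun h hh => ⟨hh.1, le_antisymm (hh.2 ▸ hle h hh.1) (hr h hh.1)⟩, fun hsub => ?_⟩
      have h0 := (hsub ⟨hg, hg0⟩).2
      rw [rowMinor_update_add_smul r hg.1.injective, hg0, zero_add] at h0
      exact (mul_pos ht hpos).ne' h0
    have hc := continuous_rowMinor_perturb r (g p) j
    have hlim := le_of_tendsto_of_tendsto
      ((((hc x).mul (hc y)).tendsto 0).mono_left (nhdsWithin_le_nhds (s := Set.Ioi 0)))
      ((((hc (x ⊓ y)).mul (hc (x ⊔ y))).tendsto 0).mono_left nhdsWithin_le_nhds)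
      (Filter.eventually_of_mem self_mem_nhdsWithin hpert)
    simpa using hlim

/-! ### Transfer to index sets and the lattice structure. -/

/-- The rows of `A`, indexed by natural numbers and extended by zero. -/
def rowExtend {m n : ℕ} (A : Matrix (Fin (m + n)) (Fin m) ℝ) (i : ℕ) : Fin m → ℝ :=
  if h : i < m + n then A ⟨i, h⟩ else 0

/-- The increasing enumeration of an index set, with natural numbers as values. -/
def IndexSet.natEnum {m n : ℕ} (I : IndexSet m n) (k : Fin m) : ℕ := I.enum k

theorem IndexSet.isIndex_natEnum {m n : ℕ} (I : IndexSet m n) : IsIndex (m + n) I.natEnum :=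
  ⟨fun _ _ h => I.enum.strictMono h, fun k => (I.enum k).2⟩

theorem IndexSet.enum_eq {m n : ℕ} (I : IndexSet m n) {f : Fin m → Fin (m + n)}
    (hf : ∀ k, f k ∈ I.1) (hmono : StrictMono f) : I.enum = f :=
  (Finset.orderEmbOfFin_unique I.2 hf hmono).symm

theorem IndexSet.enum_injective {m n : ℕ} :
    Injective fun (I : IndexSet m n) (k : Fin m) => I.enum k := by
  intro I J h
  apply Subtype.ext
  rw [← Finset.coe_inj, ← Finset.range_orderEmbOfFin I.1 I.2, ← Finset.range_orderEmbOfFin J.1 J.2]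
  exact congrArg Set.range h

theorem IndexSet.enum_maxSet {m n : ℕ} (I J : IndexSet m n) :
    (fun k => (I.maxSet J).enum k) = (fun k => I.enum k) ⊔ fun k => J.enum k :=
  IndexSet.enum_eq _ (fun k => Finset.mem_image_of_mem _ (Finset.mem_univ k)) (I.strictMono_max J)

theorem IndexSet.enum_minSet {m n : ℕ} (I J : IndexSet m n) :
    (fun k => (I.minSet J).enum k) = (fun k => I.enum k) ⊓ fun k => J.enum k :=
  IndexSet.enum_eq _ (fun k => Finset.mem_image_of_mem _ (Finset.mem_univ k)) (I.strictMono_min J)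

theorem IndexSet.natEnum_maxSet {m n : ℕ} (I J : IndexSet m n) :
    (I.maxSet J).natEnum = I.natEnum ⊔ J.natEnum := by
  ext k
  exact (congrArg Fin.val (congrFun (I.enum_maxSet J) k)).trans
    (Fin.val_strictMono.monotone.map_sup _ _)

theorem IndexSet.natEnum_minSet {m n : ℕ} (I J : IndexSet m n) :
    (I.minSet J).natEnum = I.natEnum ⊓ J.natEnum := by
  ext k
  exact (congrArg Fin.val (congrFun (I.enum_minSet J) k)).trans
    (Fin.val_strictMono.monotone.map_inf _ _)

theorem rowMinor_rowExtend_natEnum {m n : ℕ} (A : Matrix (Fin (m + n)) (Fin m) ℝ)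
    (I : IndexSet m n) : rowMinor (rowExtend A) I.natEnum = plucker A I := by
  unfold rowMinor plucker
  congr 1
  ext k l
  simp [rowExtend, IndexSet.natEnum]

theorem exists_natEnum_eq {m n : ℕ} {g : Fin m → ℕ} (hg : IsIndex (m + n) g) :
    ∃ I : IndexSet m n, I.natEnum = g := by
  have hmono : StrictMono fun k => (⟨g k, hg.2 k⟩ : Fin (m + n)) := fun _ _ h => hg.1 h
  let I : IndexSet m n := ⟨Finset.univ.image fun k => ⟨g k, hg.2 k⟩, by
    rw [Finset.card_image_of_injective _ hmono.injective, Finset.card_fin]⟩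
  refine ⟨I, funext fun k => ?_⟩
  exact congrArg Fin.val (congrFun
    (I.enum_eq (fun k => Finset.mem_image_of_mem _ (Finset.mem_univ k)) hmono) k)

theorem plucker_mul_le {m n : ℕ} {A : Matrix (Fin (m + n)) (Fin m) ℝ}
    (hpos : ∀ I : IndexSet m n, 0 ≤ plucker A I) (I J : IndexSet m n) :
    plucker A I * plucker A J ≤ plucker A (I.minSet J) * plucker A (I.maxSet J) := by
  simp only [← rowMinor_rowExtend_natEnum, IndexSet.natEnum_maxSet, IndexSet.natEnum_minSet]
  refine rowMinor_mul_le_inf_mul_sup (fun g hg => ?_) I.isIndex_natEnum J.isIndex_natEnum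
  obtain ⟨K, rfl⟩ := exists_natEnum_eq hg
  rw [rowMinor_rowExtend_natEnum]
  exact hpos K

/-- The distributive lattice with join `max` and meet `min` on a family of index sets closed under
these operations. -/
abbrev distribLatticeOfClosed {m n : ℕ} (S : Set (IndexSet m n))
    (hmax : ∀ I ∈ S, ∀ J ∈ S, I.maxSet J ∈ S) (hmin : ∀ I ∈ S, ∀ J ∈ S, I.minSet J ∈ S) :
    DistribLattice S :=
  letI : Max S := ⟨fun I J => ⟨I.1.maxSet J.1, hmax _ I.2 _ J.2⟩⟩
  letI : Min S := ⟨fun I J => ⟨I.1.minSet J.1, hmin _ I.2 _ J.2⟩⟩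
  letI : LE S := ⟨fun I J => (fun k => I.1.enum k) ≤ fun k => J.1.enum k⟩
  letI : LT S := ⟨fun I J => (fun k => I.1.enum k) < fun k => J.1.enum k⟩
  Injective.distribLattice (fun (I : S) (k : Fin m) => I.1.enum k)
    (IndexSet.enum_injective.comp Subtype.val_injective) Iff.rfl Iff.rfl
    (fun I J => I.1.enum_maxSet J.1) (fun I J => I.1.enum_minSet J.1)

end TNNGrass

theorem mainTheorem7 (m n : ℕ) (hm : 1 ≤ m) (hmn : m ≤ n)
    (V : TNNGrass.Gr m n) (hV : V ∈ TNNGrass.GrNonneg m n)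
    (W : TNNGrass.Gr m n) (hW : W ∈ TNNGrass.positroidCell V)
    (A : Matrix (Fin (m + n)) (Fin m) ℝ) (hA : TNNGrass.Represents A W)
    (hpos : ∀ I : TNNGrass.IndexSet m n, 0 ≤ TNNGrass.plucker A I) :
    ∃ _ : DistribLattice (TNNGrass.positroid V),
      (∀ I J : TNNGrass.positroid V,
        ((I ⊔ J : TNNGrass.positroid V) : TNNGrass.IndexSet m n) =
          TNNGrass.IndexSet.maxSet I.1 J.1) ∧
      (∀ I J : TNNGrass.positroid V,
        ((I ⊓ J : TNNGrass.positroid V) : TNNGrass.IndexSet m n) =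
          TNNGrass.IndexSet.minSet I.1 J.1) ∧
      TNNGrass.LogSupermodular
        (fun I : TNNGrass.positroid V => TNNGrass.plucker A I.1) := by
  have hmem : ∀ I, I ∈ TNNGrass.positroid V ↔ 0 < TNNGrass.plucker A I := fun I => by
    rw [← hW.2, TNNGrass.mem_positroid_iff hA, (hpos I).lt_iff_ne']
  have hle := TNNGrass.plucker_mul_le hpos
  have hprod : ∀ I ∈ TNNGrass.positroid V, ∀ J ∈ TNNGrass.positroid V,
      0 < TNNGrass.plucker A (I.minSet J) * TNNGrass.plucker A (I.maxSet J) := fun I hI J hJ =>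
    (mul_pos ((hmem I).1 hI) ((hmem J).1 hJ)).trans_le (hle I J)
  refine ⟨TNNGrass.distribLatticeOfClosed _
    (fun I hI J hJ => (hmem _).2 (pos_of_mul_pos_right (hprod I hI J hJ) (hpos _)))
    (fun I hI J hJ => (hmem _).2 (pos_of_mul_pos_left (hprod I hI J hJ) (hpos _))),
    fun I J => rfl, fun I J => rfl, fun I => (hmem _).1 I.2, fun I J => ?_⟩
  have hI := (hmem _).1 I.2
  have hJ := (hmem _).1 J.2
  have hmin := pos_of_mul_pos_left (hprod I I.2 J J.2) (hpos _)
  have hmax := pos_of_mul_pos_right (hprod I I.2 J J.2) (hpos _)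
  change Real.log (TNNGrass.plucker A I.1) + Real.log (TNNGrass.plucker A J.1) ≤
    Real.log (TNNGrass.plucker A (I.1.maxSet J.1)) + Real.log (TNNGrass.plucker A (I.1.minSet J.1))
  rw [← Real.log_mul hI.ne' hJ.ne', ← Real.log_mul hmax.ne' hmin.ne',
    mul_comm (TNNGrass.plucker A (I.1.maxSet J.1))]
  exact Real.log_le_log (mul_pos hI hJ) (hle I.1 J.1)
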